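/- Let $k$ be an algebraically closed field of characteristic $2$ and let $n\ge 2$ be an integer. Call a polynomial $F(X,Y)\in k[X][Y]$, monic in $Y$ of degree $n$ and without multiple roots over the field $k(X)$, an unramified covering of the affine line over $k$ if for every $c\in k$ there are power series $\eta_1,\dots,\eta_n\in k[[X]]$ with $F(X+c,Y)=\prod_{i=1}^n (Y-\eta_i)$. Let $\pi_A(L_k)$ denote the family of Galois groups $\operatorname{Gal}(L/k(X))$, where $L$ runs over all finite Galois extensions of $k(X)$ in which no point of the affine line is ramified, that is, such that for every $c\in k$ the prime $(X-c)$ of $k[X]$ is unramified in the integral closure of $k[X]$ in $L$. Then there exists an unramified covering $F(X,Y)$ of the affine line over $k$, of degree $n$ in $Y$, whose Galois group $\operatorname{Gal}(F,k(X))$, as a group of permutations of the $n$ roots of $F$ in a splitting field over $k(X)$, is the full symmetric group of degree $n$. Equivalently, the symmetric group $S_n$ belongs to $\pi_A(L_k)$; both statements hold. -/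

import Mathlib

open Polynomial

universe u v

noncomputable section

/-- Substitution `X ↦ X + c` followed by the inclusion of `k[X]` into `k⟦X⟧`: the power series
expansion of a polynomial at the point `X = c` of the affine line. -/
def expandAt {k : Type u} [Field k] (c : k) : k[X] →+* PowerSeries k :=
  (Polynomial.coeToPowerSeries.ringHom (R := k)).comp (Polynomial.compRingHom (X + C c))

/-- `F(X, Y)`, as a polynomial in `Y` over the field of rational functions `k(X)`. -/
def overFunctionField {k : Type u} [Field k] (F : k[X][X]) : (RatFunc k)[X] :=
  F.map (algebraMap k[X] (RatFunc k))

/-- A bivariate polynomial `F(X, Y)` over `k` (inner variable `X`, outer variable `Y`) is an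
unramified covering of the affine line over `k`: it is monic in `Y`, it has no multiple roots
over `k(X)`, and for every `c` in `k` the polynomial `F(X + c, Y)` is a product of factors
`Y - η(X)` with `η(X)` in the power series ring `k⟦X⟧`. -/
structure IsUnramifiedCovering {k : Type u} [Field k] (F : k[X][X]) : Prop where
  monic : F.Monic
  separable : (overFunctionField F).Separable
  unramified : ∀ c : k, ∃ η : Fin F.natDegree → PowerSeries k,
    F.map (expandAt c) = ∏ i, (X - C (η i))

/-- No point of the affine line over `k` is ramified in the extension `L` of `k(X)`: for every
`c` in `k`, the prime `(X - c)` of `k[X]` is unramified in the integral closure of `k[X]` in `L`.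
(For algebraically closed `k` these primes are all the points of the affine line.) -/
def UnramifiedOverAffineLine (k : Type u) [Field k] (L : Type v) [Field L] [Algebra k[X] L] :
    Prop :=
  ∀ c : k, Algebra.IsUnramifiedIn (integralClosure k[X] L) (Ideal.span {(X - C c : k[X])})

/-- `G` belongs to the algebraic fundamental group `π_A` of the affine line over `k`, i.e. `G` is
the Galois group of a finite Galois extension `L` of `k(X)` in which no point of the affine line
is ramified. -/
def MemPiAAffineLine (k : Type u) [Field k] (G : Type v) [Group G] : Prop :=
  ∃ (L : Type u) (_ : Field L) (_ : Algebra (RatFunc k) L) (_ : Algebra k[X] L)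
    (_ : IsScalarTower k[X] (RatFunc k) L),
    FiniteDimensional (RatFunc k) L ∧ IsGalois (RatFunc k) L ∧
      UnramifiedOverAffineLine k L ∧ Nonempty ((L ≃ₐ[RatFunc k] L) ≃* G)

/-- The Galois group `Gal(F, k(X))` of `F(X, Y)`, as a group of permutations of the roots of `F` in
a splitting field over `k(X)`. -/
def galoisPermGroup {k : Type u} [Field k] (F : k[X][X]) :
    Subgroup (Equiv.Perm ((overFunctionField F).rootSet (overFunctionField F).SplittingField)) :=
  haveI : Fact (((overFunctionField F).map
      (algebraMap (RatFunc k) (overFunctionField F).SplittingField)).Splits) :=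
    ⟨SplittingField.splits _⟩
  (Gal.galActionHom (overFunctionField F) (overFunctionField F).SplittingField).range

end

/-! The covering is `F = f(Y) + X g(Y)` with `f` monic of degree `n`, `g` a product of `n - 2`
distinct linear factors and `(f g)' = 1`; such `f` and `g` come from splitting `Y ^ (2n - 2) + Y`
into linear factors. In characteristic 2 one has `g F_Y + g' F = (f g)' = 1`, so the roots of `F`
stay distinct modulo every prime over the affine line: Hensel's lemma gives the power series roots,
and inertia acts trivially on the splitting field `L`.

At infinity put `t = 1 / X`. Then `t F = t f + g` reduces to `g` modulo `t`, so `n - 2` roots lie in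
`k⟦t⟧`. The other two roots `a`, `b` satisfy a quadratic over `k⟦t⟧` without roots in `k((t))`,
hence are conjugate over `k((t))`, and the Galois group contains the transposition `(a b)`
(`exists_transposition_at_infinity`).

It remains to see that all roots are linked by transpositions (`isTransposable_roots_pencil`). Being
equal or exchanged by a transposition of the group is a Galois-stable equivalence relation. Let `S`
be a class and `P = ∏ (Y - y)` over `y ∈ S`. Since `g F_Y = 1` at a root, `dy/dX = g(y) ^ 2` in
characteristic 2, so `dP/dX` is `flowDerivative` up to sign; its coefficients are integral over
`k[X]`. As `d/dX = t ^ 2 d/dt`, they vanish at infinity if `S` contains neither `a` nor `b`. If `S`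
contains both, then `t P` has coefficients in `k⟦t⟧`, and `dP/dX` is still regular. No class
contains just one of them. Hence for a class missing `a` the coefficients of `dP/dX` are integral,
regular at all places over infinity and zero at one of them, so `dP/dX = 0`. But its value at `y ∈
S` is, up to sign, `g(y) ^ 2 P'(y) ≠ 0`. So there is only one class. -/

noncomputable section

/-! ### Hensel lifting over power series -/

/-- Hensel's lemma for polynomials that need not be monic. -/
theorem IsAdicComplete.exists_isRoot_sub_mem {R : Type*} [CommRing R] (I : Ideal R)
    [IsAdicComplete I R] (f : R[X]) (a₀ : R) (h₁ : f.eval a₀ ∈ I)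
    (h₂ : IsUnit (f.derivative.eval a₀)) : ∃ a : R, f.IsRoot a ∧ a - a₀ ∈ I := by
  let f' := derivative f
  -- Newton iteration. `Ring.inverse` is `0` on non-units, but the derivative stays a unit at every
  -- iterate because these are all congruent to `a₀` modulo `I`.
  let c : ℕ → R := fun n => Nat.recOn n a₀ fun _ b => b - f.eval b * Ring.inverse (f'.eval b)
  have hc : ∀ n, c (n + 1) = c n - f.eval (c n) * Ring.inverse (f'.eval (c n)) := fun n => rfl
  have hfc : ∀ n, c n - a₀ ∈ I ∧ f.eval (c n) ∈ I ^ (n + 1) := by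
    intro n
    induction n with
    | zero => simpa [c] using h₁
    | succ n ih =>
      obtain ⟨ih₁, ih₂⟩ := ih
      have hu : IsUnit (f'.eval (c n)) := by
        have := isLocalHom_of_le_jacobson_bot I (IsAdicComplete.le_jacobson_bot I)
        apply IsUnit.of_map (Ideal.Quotient.mk I)
        have : Ideal.Quotient.mk I (f'.eval (c n)) = Ideal.Quotient.mk I (f'.eval a₀) :=
          Ideal.Quotient.eq.2 (I.mem_of_dvd (sub_dvd_eval_sub _ _ _) ih₁)
        rw [this]
        exact h₂.map _
      have hm : f.eval (c n) * Ring.inverse (f'.eval (c n)) ∈ I ^ (n + 1) :=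
        Ideal.mul_mem_right _ _ ih₂
      refine ⟨?_, ?_⟩
      · rw [hc, sub_right_comm]
        exact I.sub_mem ih₁ (Ideal.pow_le_self (Nat.succ_ne_zero n) hm)
      · obtain ⟨e, he⟩ := f.binomExpansion (c n) (-(f.eval (c n) * Ring.inverse (f'.eval (c n))))
        rw [hc, sub_eq_add_neg, he]
        have hz : f.eval (c n) + eval (c n) (derivative f) *
            -(f.eval (c n) * Ring.inverse (f'.eval (c n))) = 0 := by
          have := Ring.mul_inverse_cancel _ hu
          linear_combination (-f.eval (c n)) * this
        rw [hz, zero_add]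
        refine Ideal.mul_mem_left _ _ ?_
        rw [neg_sq]
        -- The error is in fact squared at each step; gaining one power of `I` is enough for
        -- convergence.
        refine Ideal.pow_le_pow_right (by lia : n + 1 + 1 ≤ (n + 1) * 2) ?_
        rw [pow_mul]
        exact Ideal.pow_mem_pow hm 2
  have aux : ∀ m n, m ≤ n → c m ≡ c n [SMOD (I ^ m • ⊤ : Ideal R)] := by
    intro m n hmn
    rw [smul_eq_mul, Ideal.mul_top]
    induction n, hmn using Nat.le_induction with
    | base => rfl
    | succ n hmn ih =>
      refine ih.trans ?_
      rw [SModEq.sub_mem, hc, sub_sub_cancel]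
      exact Ideal.mul_mem_right _ _ (Ideal.pow_le_pow_right (by lia) (hfc n).2)
  obtain ⟨a, ha⟩ := IsPrecomplete.prec' c (aux _ _)
  simp only [smul_eq_mul, Ideal.mul_top] at ha
  refine ⟨a, IsHausdorff.haus' (I := I) _ fun n => ?_, ?_⟩
  · rw [smul_eq_mul, Ideal.mul_top]
    refine ((ha n).symm.eval f).trans ?_
    rw [SModEq.zero]
    exact Ideal.pow_le_pow_right n.le_succ (hfc n).2
  · have h := SModEq.sub_mem.1 (ha 1)
    rw [pow_one] at h
    have := I.sub_mem (hfc 1).1 h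
    rwa [sub_sub_sub_cancel_left] at this

theorem exists_powerSeries_isRoot {k : Type*} [Field k] (f : (PowerSeries k)[X])
    (c : k) (h₁ : (f.map PowerSeries.constantCoeff).IsRoot c)
    (h₂ : (f.map PowerSeries.constantCoeff).derivative.eval c ≠ 0) :
    ∃ a, f.IsRoot a ∧ PowerSeries.constantCoeff a = c := by
  have hev : ∀ p : (PowerSeries k)[X], PowerSeries.constantCoeff (p.eval (PowerSeries.C c)) =
      (p.map PowerSeries.constantCoeff).eval c := fun p => by
    have := eval₂_at_apply (p := p) (PowerSeries.constantCoeff (R := k)) (PowerSeries.C c)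
    rw [eval_map, ← this, PowerSeries.constantCoeff_C]
  have h₁' : f.eval (PowerSeries.C c) ∈ Ideal.span {(PowerSeries.X : PowerSeries k)} := by
    rw [Ideal.mem_span_singleton, PowerSeries.X_dvd_iff, hev]
    exact h₁
  have h₂' : IsUnit (f.derivative.eval (PowerSeries.C c)) := by
    rw [PowerSeries.isUnit_iff_constantCoeff, hev, ← derivative_map]
    exact h₂.isUnit
  obtain ⟨a, ha, hac⟩ := IsAdicComplete.exists_isRoot_sub_mem _ f _ h₁' h₂'
  refine ⟨a, ha, ?_⟩
  rw [Ideal.mem_span_singleton, PowerSeries.X_dvd_iff, map_sub, sub_eq_zero] at hac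
  simpa using hac

/-- Lifts of distinct residues are distinct. Divisibility is all that can be claimed, since the
leading coefficient may vanish under reduction, as happens for `t f + g`. -/
theorem exists_powerSeries_prod_X_sub_C_dvd {k : Type*} [Field k] (f : (PowerSeries k)[X])
    (s : Finset k) (h₁ : ∀ c ∈ s, (f.map PowerSeries.constantCoeff).IsRoot c)
    (h₂ : ∀ c ∈ s, (f.map PowerSeries.constantCoeff).derivative.eval c ≠ 0) :
    ∃ r : k → PowerSeries k, (∀ c ∈ s, PowerSeries.constantCoeff (r c) = c) ∧
      ∏ c ∈ s, (X - C (r c)) ∣ f := by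
  choose! r hr hrc using fun c hc =>
    exists_powerSeries_isRoot f c (h₁ c hc) (h₂ c hc)
  refine ⟨r, hrc, ?_⟩
  rcases eq_or_ne f 0 with rfl | hf
  · exact dvd_zero _
  have h := (Multiset.prod_X_sub_C_dvd_iff_le_roots hf (s.val.map r)).2 ?_
  · rwa [Multiset.map_map] at h
  · refine (Multiset.le_iff_subset ?_).2 fun x hx => ?_
    · refine Multiset.Nodup.map_on (fun x hx y hy hxy => ?_) s.nodup
      rw [← hrc x hx, ← hrc y hy, hxy]
    · obtain ⟨c, hc, rfl⟩ := Multiset.mem_map.1 hx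
      exact (mem_roots hf).2 (hr c hc)

theorem exists_powerSeries_eq_prod_X_sub_C {k : Type*} [Field k] [IsAlgClosed k]
    (f : (PowerSeries k)[X]) (hf : f.Monic)
    (hs : (f.map PowerSeries.constantCoeff).Separable) :
    ∃ η : Fin f.natDegree → PowerSeries k, f = ∏ i, (X - C (η i)) := by
  classical
  set p := f.map PowerSeries.constantCoeff
  have hp : p.Monic := hf.map _
  obtain ⟨r, -, hr⟩ := exists_powerSeries_prod_X_sub_C_dvd f p.roots.toFinset
    (fun c hc => by simpa [hp.ne_zero] using hc)
    (fun c hc => by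
      have : p.IsRoot c := by simpa [hp.ne_zero] using hc
      exact hs.eval₂_derivative_ne_zero (RingHom.id k) this)
  have hcard : p.roots.toFinset.card = f.natDegree := by
    rw [Multiset.toFinset_card_of_nodup (nodup_roots hs), ← hf.natDegree_map
      (PowerSeries.constantCoeff (R := k)), (IsAlgClosed.splits p).natDegree_eq_card_roots]
  have heq : ∏ c ∈ p.roots.toFinset, (X - C (r c)) = f := by
    refine (eq_of_monic_of_dvd_of_natDegree_le (monic_prod_X_sub_C _ _) hf hr ?_).symm
    rw [natDegree_finsetProd_X_sub_C_eq_card, hcard]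
  let e := (Finset.equivFinOfCardEq hcard).symm
  refine ⟨fun i => r (e i), ?_⟩
  refine heq.symm.trans ((Finset.prod_coe_sort _ _).symm.trans ?_)
  exact (e.prod_comp fun c => X - C (r c)).symm

/-! ### Unramifiedness over the affine line -/

/-- A monic polynomial `F(X, Y)` that generates the unit ideal of `k[X, Y]` together with its
`Y`-derivative is an unramified covering of the affine line. -/
theorem isUnramifiedCovering_of_isCoprime {k : Type u} [Field k] [IsAlgClosed k] {F : k[X][X]}
    (hF : F.Monic) (h : IsCoprime F (derivative F)) : IsUnramifiedCovering F where
  monic := hF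
  separable := Separable.map (f := algebraMap k[X] (RatFunc k)) h
  unramified c := by
    have hs : F.Separable := h
    have := exists_powerSeries_eq_prod_X_sub_C (F.map (expandAt c)) (hF.map _) (hs.map).map
    rwa [hF.natDegree_map] at this

/-- Reduction modulo a proper ideal is injective on the roots of a polynomial that is coprime to
its derivative. -/
theorem Polynomial.Separable.eq_of_sub_mem {B : Type*} [CommRing B] [IsDomain B] {p : B[X]}
    (hp : p.Separable) {Q : Ideal B} (hQ : Q ≠ ⊤) {y z : B} (hy : p.IsRoot y) (hz : p.IsRoot z)
    (h : z - y ∈ Q) : z = y := by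
  by_contra hne
  -- Dividing the Taylor expansion at `y` by `z - y ≠ 0` gives `p'(y) = -e (z - y) ∈ Q`, although
  -- `p'(y)` is a unit.
  obtain ⟨e, he⟩ := p.binomExpansion y (z - y)
  rw [add_sub_cancel, hz.eq_zero, hy.eq_zero, zero_add, sq, ← mul_assoc, ← add_mul, eq_comm,
    mul_eq_zero, or_iff_left (sub_ne_zero.2 hne)] at he
  obtain ⟨a, b, hab⟩ := hp
  have h1 := congrArg (eval y) hab
  simp only [eval_add, eval_mul, hy.eq_zero, mul_zero, zero_add, eval_one] at h1
  refine hQ ((Ideal.eq_top_iff_one Q).2 ?_)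
  rw [← h1, eq_neg_of_add_eq_zero_left he]
  exact Q.mul_mem_left _ (Q.neg_mem (Q.mul_mem_left _ h))

/-- The residue field is `k` itself. Perfectness rules out inseparable residue extensions, so that
ramification is measured by inertia groups. -/
theorem perfectField_residueField_span_X_sub_C {k : Type*} [Field k] [PerfectField k]
    {p : Ideal k[X]} [p.IsPrime] {c : k} (hp : p = Ideal.span {X - C c}) :
    PerfectField p.ResidueField := by
  subst hp
  have : (Ideal.span {(X - C c : k[X])}).IsMaximal :=
    PrincipalIdealRing.isMaximal_of_irreducible (irreducible_X_sub_C c)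
  exact PerfectField.of_ringEquiv ((quotientSpanXSubCAlgEquiv c).symm.toRingEquiv.trans
    (RingEquiv.ofBijective _
      (Ideal.bijective_algebraMap_quotient_residueField (Ideal.span {(X - C c : k[X])}))))

/-- No point of the affine line is ramified in the splitting field of a monic polynomial that
generates the unit ideal of `k[X, Y]` together with its `Y`-derivative. -/
theorem unramifiedOverAffineLine_of_isCoprime {k : Type u} [Field k] [IsAlgClosed k] {F : k[X][X]}
    (hF : F.Monic) (h : IsCoprime F (derivative F)) (L : Type v) [Field L] [Algebra (RatFunc k) L]
    [Algebra k[X] L] [IsScalarTower k[X] (RatFunc k) L]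
    [IsSplittingField (RatFunc k) L (overFunctionField F)] : UnramifiedOverAffineLine k L := by
  have hsep : (overFunctionField F).Separable := Separable.map (f := algebraMap k[X] (RatFunc k)) h
  have : IsGalois (RatFunc k) L := IsGalois.of_separable_splitting_field hsep
  have : FiniteDimensional (RatFunc k) L :=
    IsSplittingField.finiteDimensional L (overFunctionField F)
  have : Module.Finite k[X] (integralClosure k[X] L) := IsIntegralClosure.finite k[X] (RatFunc k) L _
  have : IsDedekindDomain (integralClosure k[X] L) :=
    IsIntegralClosure.isDedekindDomain k[X] (RatFunc k) L _
  have : IsFractionRing (integralClosure k[X] L) L :=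
    IsIntegralClosure.isFractionRing_of_finite_extension k[X] (RatFunc k) L _
  have : IsGaloisGroup (L ≃ₐ[RatFunc k] L) k[X] (integralClosure k[X] L) :=
    IsGaloisGroup.of_isFractionRing _ _ _ (RatFunc k) L
  have : FaithfulSMul k[X] L := (faithfulSMul_iff_algebraMap_injective _ _).2 <| by
    rw [IsScalarTower.algebraMap_eq k[X] (RatFunc k) L]
    exact (algebraMap (RatFunc k) L).injective.comp (IsFractionRing.injective _ _)
  have : Module.IsTorsionFree k[X] (integralClosure k[X] L) :=
    Module.isTorsionFree_iff_algebraMap_injective.2 (FaithfulSMul.algebraMap_injective _ _)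
  have : Module.Free k[X] (integralClosure k[X] L) := Module.free_of_finite_type_torsion_free'
  have : Module.Flat k[X] (integralClosure k[X] L) := Module.Flat.of_free
  intro c Q _ hQ
  have hunder : Q.under k[X] = Ideal.span {X - C c} := hQ.over.symm
  have : PerfectField (Q.under k[X]).ResidueField :=
    perfectField_residueField_span_X_sub_C hunder
  -- The goal becomes triviality of the inertia group of `Q`: an inertia element fixes each root
  -- modulo `Q`, hence fixes it, and the roots generate `L`.
  rw [← Ideal.ramificationIdx_eq_one_iff,
    ← Ideal.ramificationIdxIn_eq_ramificationIdx (Q.under k[X]) Q (L ≃ₐ[RatFunc k] L),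
    ← Ideal.card_inertia_eq_ramificationIdxIn (G := L ≃ₐ[RatFunc k] L) (Q.under k[X]) Q,
    Subgroup.card_eq_one, eq_bot_iff]
  intro σ hσ
  rw [Subgroup.mem_bot]
  refine AlgEquiv.coe_toAlgHom_injective (AlgHom.ext_of_adjoin_eq_top
    (IsSplittingField.adjoin_rootSet L (overFunctionField F)) fun y hy => ?_)
  have hy0 : aeval y F = 0 := by
    have := (mem_rootSet.1 hy).2
    rwa [overFunctionField, aeval_map_algebraMap] at this
  let y' : integralClosure k[X] L := ⟨y, F, hF, hy0⟩
  have hroot : ∀ z : integralClosure k[X] L, aeval (z : L) F = 0 →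
      (F.map (algebraMap k[X] (integralClosure k[X] L))).IsRoot z := fun z hz => by
    rw [IsRoot, eval_map_algebraMap]
    exact Subtype.ext ((aeval_algebraMap_apply L z F).symm.trans hz)
  have := Separable.eq_of_sub_mem (Separable.map (f := algebraMap k[X] _) h) (Ideal.IsPrime.ne_top ‹_›)
    (hroot y' hy0) (hroot (σ • y') ?_) (hσ y')
  · exact congrArg Subtype.val this
  · have : ((σ • y' : integralClosure k[X] L) : L) = σ y := rfl
    rw [this]
    have := congrArg (σ.restrictScalars k[X]) hy0
    rwa [map_zero, ← aeval_algHom_apply] at this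

/-! ### Differentiating a product of linear factors along the flow -/

open scoped Classical in
/-- The derivative of `∏ y ∈ S, (Y - y)`, up to sign, with respect to a derivation that takes each
`y ∈ S` to `G(y) ^ 2`. -/
def flowDerivative {E : Type*} [Field E] (G : E[X]) (S : Finset E) : E[X] :=
  ∑ y ∈ S, C (G.eval y ^ 2) * ∏ z ∈ S.erase y, (X - C z)

theorem eval_flowDerivative {E : Type*} [Field E] (G : E[X]) (S : Finset E) {y : E} (hy : y ∈ S) :
    (flowDerivative G S).eval y =
      G.eval y ^ 2 * (derivative (∏ z ∈ S, (X - C z))).eval y := by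
  classical
  rw [flowDerivative, eval_finsetSum, Finset.sum_eq_single y, derivative_prod_finset,
    eval_finsetSum, Finset.sum_eq_single y]
  · simp [eval_prod]
  · intro b _ hby
    simp [eval_prod, Finset.prod_eq_zero (Finset.mem_erase.2 ⟨hby.symm, hy⟩)]
  · exact fun h => absurd hy h
  · intro b _ hby
    simp [eval_prod, Finset.prod_eq_zero (Finset.mem_erase.2 ⟨hby.symm, hy⟩)]
  · exact fun h => absurd hy h

theorem degree_flowDerivative_lt {E : Type*} [Field E] (G : E[X]) (S : Finset E) :
    (flowDerivative G S).degree < S.card := by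
  classical
  refine (degree_sum_le _ _).trans_lt ((Finset.sup_lt_iff (WithBot.bot_lt_coe _)).2 fun y hy => ?_)
  refine (degree_mul_le _ _).trans_lt ?_
  refine (add_le_add_left degree_C_le _).trans_lt ?_
  rw [zero_add]
  refine (Lagrange.degree_nodal (s := S.erase y) (v := id)).trans_lt ?_
  exact_mod_cast Finset.card_erase_lt_of_mem hy

theorem map_flowDerivative {E E' : Type*} [Field E] [Field E'] (φ : E →+* E') (G : E[X])
    (S : Finset E) :
    (flowDerivative G S).map φ = flowDerivative (G.map φ) (S.map ⟨φ, φ.injective⟩) := by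
  classical
  rw [flowDerivative, flowDerivative, Polynomial.map_sum, Finset.sum_map]
  refine Finset.sum_congr rfl fun y _ => ?_
  rw [← Finset.map_erase, Finset.prod_map, Polynomial.map_mul, Polynomial.map_prod, map_C]
  simp [eval_map_apply]

/-! ### The flow at infinity in the coordinate `t` -/

/-- The coefficientwise derivative of a polynomial with power series coefficients. -/
def coeffDerivative (k : Type*) [Field k] :
    Derivation k (PowerSeries k)[X] (PowerSeries k)[X] :=
  PolynomialModule.equivPolynomialSelf.compDer (PowerSeries.derivative k).mapCoeffs

theorem coeff_coeffDerivative {k : Type*} [Field k] (p : (PowerSeries k)[X]) (i : ℕ) :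
    (coeffDerivative k p).coeff i = PowerSeries.derivative k (p.coeff i) := rfl

theorem coeffDerivative_map_C {k : Type*} [Field k] (p : k[X]) :
    coeffDerivative k (p.map PowerSeries.C) = 0 := by
  ext1 i
  rw [coeff_coeffDerivative, coeff_map, coeff_zero]
  exact (PowerSeries.derivative k).map_algebraMap _

theorem coeffDerivative_C_X_mul {k : Type*} [Field k] (p : k[X]) :
    coeffDerivative k (C PowerSeries.X * p.map PowerSeries.C) = p.map PowerSeries.C := by
  ext1 i
  rw [coeff_coeffDerivative, coeff_C_mul, coeff_map, Derivation.leibniz]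
  have : PowerSeries.derivative k (PowerSeries.C (p.coeff i)) = 0 :=
    (PowerSeries.derivative k).map_algebraMap _
  simp [this]

theorem degree_coeffDerivative_lt {k : Type*} [Field k] {p : (PowerSeries k)[X]} {n : ℕ}
    (hp : p.natDegree ≤ n) (h : PowerSeries.derivative k (p.coeff n) = 0) :
    (coeffDerivative k p).degree < n := by
  rw [degree_lt_iff_coeff_zero]
  intro m hm
  rw [coeff_coeffDerivative]
  rcases hm.eq_or_lt with rfl | hm
  · exact h
  · rw [coeff_eq_zero_of_natDegree_lt (hp.trans_lt hm), map_zero]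

/-- The polynomial `t f(Y) + g(Y)` over `k⟦t⟧`; up to the factor `t` it is `f + X g` near the point
`X = 1 / t` at infinity. -/
def atInfinity {k : Type*} [Field k] (f g : k[X]) : (PowerSeries k)[X] :=
  C PowerSeries.X * f.map PowerSeries.C + g.map PowerSeries.C

theorem coeffDerivative_atInfinity {k : Type*} [Field k] (f g : k[X]) :
    coeffDerivative k (atInfinity f g) = f.map PowerSeries.C := by
  rw [atInfinity, map_add, coeffDerivative_C_X_mul, coeffDerivative_map_C, add_zero]

/-- This is `dy/dX = g(y) ^ 2` rewritten with `d/dX = t ^ 2 d/dt`, for a root of a factor `p` of `t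
f + g`. Differentiating `p q` in `t` and in `Y` at `y` gives `p_t q = f` and `p_Y q = t f' + g'`;
combine these with `g = t f` and `f' g + f g' = 1`. -/
theorem sq_mul_aeval_derivative_eq {k E : Type*} [Field k] [CharP k 2] [Field E]
    [Algebra (PowerSeries k) E] [FaithfulSMul (PowerSeries k) E] {f g : k[X]}
    (hfg : derivative (f * g) = 1) {p q : (PowerSeries k)[X]} (hpq : p * q = atInfinity f g)
    {y : E} (hy : aeval y p = 0) :
    aeval y (g.map PowerSeries.C) ^ 2 * aeval y (derivative p) =
      algebraMap (PowerSeries k) E PowerSeries.X ^ 2 * aeval y (coeffDerivative k p) := by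
  set t := algebraMap (PowerSeries k) E PowerSeries.X with ht
  have ht0 : t ≠ 0 := (FaithfulSMul.algebraMap_injective _ _).ne_iff' (map_zero _) |>.2
    PowerSeries.X_ne_zero
  have h2 : (2 : E) = 0 := by
    rw [← map_ofNat ((algebraMap (PowerSeries k) E).comp PowerSeries.C) 2, CharTwo.two_eq_zero,
      map_zero]
  have e1 := congrArg (fun r => aeval y (coeffDerivative k r)) hpq
  have e2 := congrArg (fun r => aeval y (derivative r)) hpq
  have e3 := congrArg (aeval y) hpq
  have e4 := congrArg (fun r => aeval y (r.map (PowerSeries.C (R := k)))) hfg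
  simp only [coeffDerivative_atInfinity, Derivation.leibniz, smul_eq_mul, map_add, map_mul, hy,
    zero_mul, zero_add] at e1
  simp only [atInfinity, derivative_mul, derivative_C, map_add, map_mul, hy, aeval_C,
    zero_mul, add_zero, zero_add] at e2
  simp only [atInfinity, map_add, map_mul, hy, aeval_C, zero_mul] at e3
  simp only [derivative_mul, Polynomial.map_add, Polynomial.map_mul, Polynomial.map_one, map_add,
    map_mul, map_one, ← derivative_map] at e4
  rw [← ht] at e2 e3
  generalize aeval y (derivative (f.map (PowerSeries.C (R := k)))) = f' at *
  generalize aeval y (derivative (g.map (PowerSeries.C (R := k)))) = g' at *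
  generalize aeval y (f.map (PowerSeries.C (R := k))) = F at *
  generalize aeval y (g.map (PowerSeries.C (R := k))) = G at *
  generalize aeval y (derivative p) = p' at *
  generalize aeval y (coeffDerivative k p) = dp at *
  generalize aeval y q = Q at *
  -- Besides giving the identity after one more multiplication by `G`, this shows `Q ≠ 0`, which
  -- permits cancelling `Q`.
  have h5 : G * p' * Q = t := by linear_combination G * e2 + t * e4 - g' * e3 - t * F * g' * h2
  have hQ : Q ≠ 0 := by rintro rfl; exact ht0 (by rw [← h5, mul_zero])
  refine mul_right_cancel₀ hQ ?_
  linear_combination G * h5 - t ^ 2 * e1 - t * e3 - t ^ 2 * F * h2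

/-- Both sides have degree less than `#S` and agree at the points of `S`. The factor `t ^ 2` is the
zero at infinity for a set of roots in which none has a pole. -/
theorem flowDerivative_eq_of_map_eq_prod {k E : Type*} [Field k] [CharP k 2] [Field E]
    [Algebra (PowerSeries k) E] [FaithfulSMul (PowerSeries k) E] {f g : k[X]}
    (hfg : derivative (f * g) = 1) {p q : (PowerSeries k)[X]} (hpq : p * q = atInfinity f g)
    {S : Finset E} (hp : p.map (algebraMap (PowerSeries k) E) = ∏ y ∈ S, (X - C y)) :
    flowDerivative ((g.map PowerSeries.C).map (algebraMap (PowerSeries k) E)) S =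
      (C PowerSeries.X * (C PowerSeries.X * coeffDerivative k p)).map
        (algebraMap (PowerSeries k) E) := by
  have hinj := FaithfulSMul.algebraMap_injective (PowerSeries k) E
  have hmon : p.Monic := monic_of_injective hinj (hp ▸ monic_prod_X_sub_C _ _)
  have hdeg : p.natDegree = S.card := by
    rw [← natDegree_map_eq_of_injective hinj, hp, natDegree_finsetProd_X_sub_C_eq_card]
  refine eq_of_degrees_lt_of_eval_finset_eq S (degree_flowDerivative_lt _ _) ?_ fun y hy => ?_
  · rw [← mul_assoc, ← C_mul]
    refine (degree_map_le.trans (degree_mul_le _ _)).trans_lt ?_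
    refine (add_le_add_left degree_C_le _).trans_lt ?_
    rw [zero_add]
    refine degree_coeffDerivative_lt hdeg.le ?_
    rw [← hdeg, hmon.coeff_natDegree, Derivation.map_one_eq_zero]
  · have hy0 : aeval y p = 0 := by
      rw [← eval_map_algebraMap, hp, eval_prod, Finset.prod_eq_zero hy (by simp)]
    have := sq_mul_aeval_derivative_eq hfg hpq hy0
    rw [eval_flowDerivative _ _ hy, ← hp, derivative_map, eval_map_algebraMap, eval_map_algebraMap,
      eval_map_algebraMap, this]
    simp only [map_mul, aeval_C]
    ring

/-- Here the product is `p / t`, and `t ^ 2 d/dt (p / t) = t p_t - p`: a simple pole of the product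
becomes a regular value. The proof is again interpolation at `S`. -/
theorem flowDerivative_eq_of_map_eq_X_mul_prod {k E : Type*} [Field k] [CharP k 2] [Field E]
    [Algebra (PowerSeries k) E] [FaithfulSMul (PowerSeries k) E] {f g : k[X]}
    (hfg : derivative (f * g) = 1) {p q : (PowerSeries k)[X]} (hpq : p * q = atInfinity f g)
    {S : Finset E} (hp : p.map (algebraMap (PowerSeries k) E) =
      C (algebraMap (PowerSeries k) E PowerSeries.X) * ∏ y ∈ S, (X - C y)) :
    flowDerivative ((g.map PowerSeries.C).map (algebraMap (PowerSeries k) E)) S =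
      (C PowerSeries.X * coeffDerivative k p - p).map (algebraMap (PowerSeries k) E) := by
  have hinj := FaithfulSMul.algebraMap_injective (PowerSeries k) E
  have ht : algebraMap (PowerSeries k) E PowerSeries.X ≠ 0 :=
    (hinj.ne_iff' (map_zero _)).2 PowerSeries.X_ne_zero
  have hdeg : p.natDegree = S.card := by
    rw [← natDegree_map_eq_of_injective hinj, hp, natDegree_C_mul ht,
      natDegree_finsetProd_X_sub_C_eq_card]
  have hlead : p.coeff S.card = PowerSeries.X := hinj <| by
    have hm : (∏ y ∈ S, (X - C y)).coeff S.card = 1 := by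
      have := (monic_prod_X_sub_C (fun y : E => y) S).coeff_natDegree
      rwa [natDegree_finsetProd_X_sub_C_eq_card] at this
    rw [← coeff_map, hp, coeff_C_mul, hm, mul_one]
  refine eq_of_degrees_lt_of_eval_finset_eq S (degree_flowDerivative_lt _ _) ?_ fun y hy => ?_
  · refine degree_map_le.trans_lt ((degree_lt_iff_coeff_zero _ _).2 fun m hm => ?_)
    rw [coeff_sub, coeff_C_mul, coeff_coeffDerivative]
    rcases hm.eq_or_lt with rfl | hm
    -- The top coefficient cancels: `t * dt/dt - t = 0`.
    · rw [hlead]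
      simp [PowerSeries.derivative_X]
    · rw [coeff_eq_zero_of_natDegree_lt (hdeg.trans_lt hm), map_zero, mul_zero, sub_zero]
  · have hy0 : aeval y p = 0 := by
      rw [← eval_map_algebraMap, hp, eval_mul, eval_prod, Finset.prod_eq_zero hy (by simp), mul_zero]
    have := sq_mul_aeval_derivative_eq hfg hpq hy0
    refine mul_left_cancel₀ ht ?_
    have hd : algebraMap (PowerSeries k) E PowerSeries.X *
        eval y (derivative (∏ z ∈ S, (X - C z))) = aeval y (derivative p) := by
      rw [← eval_map_algebraMap, ← derivative_map, hp, derivative_C_mul, eval_C_mul]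
    rw [eval_flowDerivative _ _ hy, mul_left_comm, hd, eval_map_algebraMap, eval_map_algebraMap,
      this]
    simp only [map_mul, map_sub, aeval_C, hy0]
    ring

/-- The reduction modulo `t` is `g`, whose simple roots lift. The degree drops by two under
reduction, so the cofactor `q` is a quadratic both of whose roots go to infinity. -/
theorem exists_atInfinity_eq_prod_mul {k : Type*} [Field k] {f g : k[X]} {s : Finset k}
    (hg : g = ∏ c ∈ s, (X - C c)) (hf : f.Monic) (hdeg : f.natDegree = s.card + 2) :
    ∃ r : k → PowerSeries k, (∀ c ∈ s, PowerSeries.constantCoeff (r c) = c) ∧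
      ∃ q, atInfinity f g = (∏ c ∈ s, (X - C (r c))) * q ∧ q.natDegree = 2 ∧
        q.coeff 2 = PowerSeries.X ∧ q.map PowerSeries.constantCoeff = 1 := by
  have hmap : (atInfinity f g).map PowerSeries.constantCoeff = g := by
    have : (PowerSeries.constantCoeff (R := k)).comp PowerSeries.C = RingHom.id k := by ext; simp
    simp [atInfinity, Polynomial.map_map, this]
  have hmon : g.Monic := hg ▸ monic_prod_X_sub_C _ _
  have hgdeg : g.natDegree = s.card := by rw [hg, natDegree_finsetProd_X_sub_C_eq_card]
  have hsep : g.Separable := hg ▸ separable_prod_X_sub_C_iff'.2 fun _ _ _ _ h => h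
  obtain ⟨r, hr, q, hq⟩ := exists_powerSeries_prod_X_sub_C_dvd (atInfinity f g) s
    (fun c hc => by
      rw [hmap, hg, IsRoot, eval_prod, Finset.prod_eq_zero hc (by simp)])
    (fun c hc => by
      rw [hmap]
      refine hsep.eval₂_derivative_ne_zero (RingHom.id k) ?_
      rw [← eval, hg, eval_prod, Finset.prod_eq_zero hc (by simp)])
  have hR : (∏ c ∈ s, (X - C (r c))).Monic := monic_prod_X_sub_C _ _
  have hRdeg : (∏ c ∈ s, (X - C (r c))).natDegree = s.card :=
    natDegree_finsetProd_X_sub_C_eq_card _ _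
  have hcoeff : (atInfinity f g).coeff (s.card + 2) = PowerSeries.X := by
    have : f.coeff (s.card + 2) = 1 := hdeg ▸ hf.coeff_natDegree
    rw [atInfinity, coeff_add, coeff_C_mul, coeff_map, coeff_map, this,
      coeff_eq_zero_of_natDegree_lt (by lia : g.natDegree < s.card + 2)]
    simp
  have hle : (atInfinity f g).natDegree ≤ s.card + 2 := by
    refine natDegree_add_le_of_degree_le ((natDegree_C_mul_le _ _).trans ?_) ?_
    · exact natDegree_map_le.trans hdeg.le
    · exact natDegree_map_le.trans (by lia)
  have hFdeg : (atInfinity f g).natDegree = s.card + 2 :=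
    le_antisymm hle (le_natDegree_of_ne_zero (hcoeff ▸ PowerSeries.X_ne_zero))
  have hq0 : q ≠ 0 := by
    rintro rfl
    rw [hq, mul_zero, coeff_zero] at hcoeff
    exact PowerSeries.X_ne_zero hcoeff.symm
  have hqdeg : q.natDegree = 2 := by
    rw [hq, hR.natDegree_mul' hq0, hRdeg] at hFdeg
    lia
  refine ⟨r, hr, q, hq, hqdeg, ?_, ?_⟩
  · have h := congrArg leadingCoeff hq
    rw [leadingCoeff_monic_mul hR, leadingCoeff, leadingCoeff, hFdeg, hcoeff, hqdeg] at h
    exact h.symm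
  · have h := congrArg (Polynomial.map PowerSeries.constantCoeff) hq
    have hRmap : (∏ c ∈ s, (X - C (r c))).map PowerSeries.constantCoeff = g := by
      rw [hg, Polynomial.map_prod]
      exact Finset.prod_congr rfl fun c hc => by simp [hr c hc]
    rw [hmap, Polynomial.map_mul, hRmap] at h
    exact (mul_eq_left₀ hmon.ne_zero).1 h.symm

/-- A quadratic polynomial over `k⟦t⟧` with leading coefficient `t` that reduces to `1` has no root
in `k((t))`. -/
theorem aeval_ne_zero_of_map_constantCoeff_eq_one {k M : Type*} [Field k] [Field M]
    [Algebra (PowerSeries k) M] [IsFractionRing (PowerSeries k) M] {q : (PowerSeries k)[X]}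
    (hdeg : q.natDegree = 2) (h2 : q.coeff 2 = PowerSeries.X)
    (hq : q.map PowerSeries.constantCoeff = 1) (y : M) : aeval y q ≠ 0 := by
  intro hy
  have h0 : PowerSeries.constantCoeff (q.coeff 0) = 1 := by rw [← coeff_map, hq, coeff_one_zero]
  have h1 : PowerSeries.constantCoeff (q.coeff 1) = 0 := by
    rw [← coeff_map, hq, coeff_one, if_neg one_ne_zero]
  have hinj := IsFractionRing.injective (PowerSeries k) M
  rw [aeval_eq_sum_range, hdeg, Finset.sum_range_succ, Finset.sum_range_succ,
    Finset.sum_range_one, h2] at hy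
  simp only [Algebra.smul_def, pow_zero, mul_one, pow_one] at hy
  set t := algebraMap (PowerSeries k) M PowerSeries.X with ht
  have ht0 : t ≠ 0 := (hinj.ne_iff' (map_zero _)).2 PowerSeries.X_ne_zero
  -- Multiplying the equation by `t` makes it monic in `t y`, so `t y` lies in the integrally closed
  -- ring `k⟦t⟧`; then `t ∣ t y`, so `y` itself is a power series, and its equation reduces to `1 =
  -- 0`.
  obtain ⟨u, hu⟩ : ∃ u, algebraMap (PowerSeries k) M u = t * y := by
    refine IsIntegrallyClosed.isIntegral_iff.1 ⟨X ^ 2 + C (q.coeff 1) * X +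
      C (PowerSeries.X * q.coeff 0), by monicity!, ?_⟩
    simp only [eval₂_add, eval₂_mul, eval₂_pow, eval₂_X, eval₂_C, map_mul, ← ht]
    linear_combination t * hy
  have hu2 : u ^ 2 + q.coeff 1 * u + PowerSeries.X * q.coeff 0 = 0 := hinj <| by
    simp only [map_add, map_mul, map_pow, hu, ← ht, map_zero]
    linear_combination t * hy
  have hXu : PowerSeries.X ∣ u := by
    have := congrArg PowerSeries.constantCoeff hu2
    simp [h1] at this
    exact PowerSeries.X_dvd_iff.2 this
  obtain ⟨w, rfl⟩ := hXu
  have hw : PowerSeries.X * w ^ 2 + q.coeff 1 * w + q.coeff 0 = 0 :=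
    mul_left_cancel₀ PowerSeries.X_ne_zero (by linear_combination hu2)
  have := congrArg PowerSeries.constantCoeff hw
  simp [h1, h0] at this

/-! ### The pencil `f + X g` -/

/-- The polynomial `f(Y) + X g(Y)` in `k[X][Y]`. -/
def pencil {k : Type u} [Field k] (f g : k[X]) : k[X][X] :=
  f.map C + C X * g.map C

theorem natDegree_C_X_mul_map_C {k : Type u} [Field k] (g : k[X]) :
    (C X * g.map C : k[X][X]).natDegree = g.natDegree := by
  rw [natDegree_C_mul X_ne_zero, natDegree_map_eq_of_injective C_injective]

theorem natDegree_pencil {k : Type u} [Field k] {f g : k[X]} (h : g.natDegree < f.natDegree) :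
    (pencil f g).natDegree = f.natDegree := by
  rw [pencil, natDegree_add_eq_left_of_natDegree_lt] <;>
    rw [natDegree_map_eq_of_injective C_injective]
  rwa [natDegree_C_X_mul_map_C]

theorem monic_pencil {k : Type u} [Field k] {f g : k[X]} (hf : f.Monic)
    (h : g.natDegree < f.natDegree) : (pencil f g).Monic := by
  refine (hf.map C).add_of_left (degree_lt_degree ?_)
  rwa [natDegree_C_X_mul_map_C, natDegree_map_eq_of_injective C_injective]

/-- In `g F_Y + g' F` the terms containing `X` add up to `2 X g g' = 0`, leaving `(f g)' = 1`. -/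
theorem isCoprime_pencil_derivative {k : Type u} [Field k] [CharP k 2] {f g : k[X]}
    (hfg : derivative (f * g) = 1) : IsCoprime (pencil f g) (derivative (pencil f g)) := by
  refine ⟨(derivative g).map C, g.map C, ?_⟩
  have h := congrArg (Polynomial.map (C : k →+* k[X])) hfg
  rw [derivative_mul, Polynomial.map_add, Polynomial.map_mul, Polynomial.map_mul,
    Polynomial.map_one] at h
  have h2 : (2 : k[X][X]) = 0 := CharTwo.two_eq_zero
  rw [pencil, derivative_add, derivative_mul, derivative_C, zero_mul, zero_add, derivative_map,
    derivative_map]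
  linear_combination h + (C X * map C g * map C (derivative g)) * h2

theorem isCoprime_of_derivative_mul_eq_one {k : Type u} [Field k] {f g : k[X]}
    (hfg : derivative (f * g) = 1) : IsCoprime f g :=
  ⟨derivative g, derivative f, by rw [← hfg, derivative_mul]; ring⟩

theorem X_mul_map_overFunctionField_pencil {k : Type u} [Field k] (f g : k[X]) {E : Type v} [Field E]
    [Algebra (RatFunc k) E] [Algebra (PowerSeries k) E]
    (hX : algebraMap (RatFunc k) E RatFunc.X * algebraMap (PowerSeries k) E PowerSeries.X = 1)
    (hC : ∀ c, algebraMap (RatFunc k) E (RatFunc.C c) =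
      algebraMap (PowerSeries k) E (PowerSeries.C c)) :
    C (algebraMap (PowerSeries k) E PowerSeries.X) *
      (overFunctionField (pencil f g)).map (algebraMap (RatFunc k) E) =
        (atInfinity f g).map (algebraMap (PowerSeries k) E) := by
  have hcomp : ((algebraMap (RatFunc k) E).comp (algebraMap k[X] (RatFunc k))).comp C =
      (algebraMap (PowerSeries k) E).comp PowerSeries.C := by
    ext c
    simpa using hC c
  have hX' : C (algebraMap (RatFunc k) E RatFunc.X) *
      C (algebraMap (PowerSeries k) E PowerSeries.X) = 1 := by rw [← C_mul, hX, C_1]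
  simp only [overFunctionField, pencil, atInfinity, Polynomial.map_add, Polynomial.map_mul, map_C,
    Polynomial.map_map, ← RingHom.comp_assoc, hcomp, RatFunc.algebraMap_X]
  linear_combination (g.map ((algebraMap (PowerSeries k) E).comp PowerSeries.C)) * hX'

theorem exists_algEquiv_comp_eq {K L E : Type*} [Field K] [Field L] [Field E] [Algebra K L]
    [Algebra K E] [Normal K L] (ι : L →ₐ[K] E) (θ : E ≃ₐ[K] E) :
    ∃ σ : L ≃ₐ[K] L, ∀ y, ι (σ y) = θ (ι y) := by
  let _ : Algebra L E := ι.toRingHom.toAlgebra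
  have : IsScalarTower K L E := .of_algebraMap_eq fun x => (ι.commutes x).symm
  exact ⟨θ.restrictNormal L, AlgEquiv.restrictNormal_commutes θ L⟩

/-! ### The transposition at infinity -/

/-- The transposition coming from the point at infinity: over the algebraic closure `E` of the field
of Laurent series in `t = 1 / X`, all roots of `f + X g` but two lie in `k⟦t⟧`, and the remaining two
are exchanged by an automorphism over the Laurent series field. -/
theorem exists_transposition_at_infinity {k : Type u} [Field k] [CharP k 2] {f g : k[X]}
    (hfg : derivative (f * g) = 1) {s : Finset k} (hg : g = ∏ c ∈ s, (X - C c)) (hf : f.Monic)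
    (hdeg : f.natDegree = s.card + 2) {M : Type u} [Field M] [Algebra (PowerSeries k) M]
    [IsFractionRing (PowerSeries k) M] [Algebra (RatFunc k) M]
    (hX : algebraMap (RatFunc k) M RatFunc.X * algebraMap (PowerSeries k) M PowerSeries.X = 1)
    (hC : ∀ c, algebraMap (RatFunc k) M (RatFunc.C c) =
      algebraMap (PowerSeries k) M (PowerSeries.C c))
    (L : Type v) [Field L] [Algebra (RatFunc k) L]
    [IsSplittingField (RatFunc k) L (overFunctionField (pencil f g))] :
    ∃ (ι : L →ₐ[RatFunc k] AlgebraicClosure M) (a b : L) (q : (PowerSeries k)[X])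
      (ρ : L → PowerSeries k) (σ : L ≃ₐ[RatFunc k] L),
      a ≠ b ∧ a ∈ ((overFunctionField (pencil f g)).map (algebraMap (RatFunc k) L)).roots ∧
      b ∈ ((overFunctionField (pencil f g)).map (algebraMap (RatFunc k) L)).roots ∧
      q.map (algebraMap (PowerSeries k) (AlgebraicClosure M)) =
        C (algebraMap (PowerSeries k) (AlgebraicClosure M) PowerSeries.X) *
          ((X - C (ι a)) * (X - C (ι b))) ∧ σ a = b ∧ σ b = a ∧
      ∀ y ∈ ((overFunctionField (pencil f g)).map (algebraMap (RatFunc k) L)).roots,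
        y ≠ a → y ≠ b → σ y = y ∧ algebraMap (PowerSeries k) (AlgebraicClosure M) (ρ y) = ι y := by
  set p := overFunctionField (pencil f g) with hp
  set E := AlgebraicClosure M
  have hgdeg : g.natDegree = s.card := by rw [hg, natDegree_finsetProd_X_sub_C_eq_card]
  have hlt : g.natDegree < f.natDegree := by lia
  have hpmon : p.Monic := (monic_pencil hf hlt).map _
  have hpsep : p.Separable :=
    Separable.map (f := algebraMap k[X] (RatFunc k)) (isCoprime_pencil_derivative hfg)
  have hinj : Function.Injective (algebraMap (PowerSeries k) E) := by
    rw [IsScalarTower.algebraMap_eq (PowerSeries k) M E]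
    exact (algebraMap M E).injective.comp (IsFractionRing.injective _ _)
  set t := algebraMap (PowerSeries k) E PowerSeries.X with ht
  have ht0 : t ≠ 0 := (hinj.ne_iff' (map_zero _)).2 PowerSeries.X_ne_zero
  have hmap : C t * p.map (algebraMap (RatFunc k) E) = (atInfinity f g).map
      (algebraMap (PowerSeries k) E) := by
    refine X_mul_map_overFunctionField_pencil f g ?_ fun c => ?_
    · rw [IsScalarTower.algebraMap_apply (RatFunc k) M E,
        IsScalarTower.algebraMap_apply (PowerSeries k) M E, ← map_mul, hX, map_one]
    · rw [IsScalarTower.algebraMap_apply (RatFunc k) M E,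
        IsScalarTower.algebraMap_apply (PowerSeries k) M E, hC]
  obtain ⟨r, -, q, hq, hqdeg, hq2, hq1⟩ := exists_atInfinity_eq_prod_mul hg hf hdeg
  have hM : ∀ y : M, ¬ (q.map (algebraMap (PowerSeries k) M)).IsRoot y := fun y hy =>
    aeval_ne_zero_of_map_constantCoeff_eq_one hqdeg hq2 hq1 y (by rwa [← eval_map_algebraMap])
  have hqMdeg : (q.map (algebraMap (PowerSeries k) M)).natDegree = 2 := by
    rw [natDegree_map_eq_of_injective (IsFractionRing.injective _ _), hqdeg]
  have hqM0 : q.map (algebraMap (PowerSeries k) M) ≠ 0 := by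
    rintro h
    rw [h, natDegree_zero] at hqMdeg
    exact two_ne_zero hqMdeg.symm
  have hirr : Irreducible (q.map (algebraMap (PowerSeries k) M)) := by
    refine (irreducible_iff_roots_eq_zero_of_degree_le_three hqMdeg.ge (by lia)).2 ?_
    exact Multiset.eq_zero_of_forall_notMem fun y hy => hM y ((mem_roots hqM0).1 hy)
  have hqE : q.map (algebraMap (PowerSeries k) E) =
      (q.map (algebraMap (PowerSeries k) M)).map (algebraMap M E) := by
    rw [Polynomial.map_map, ← IsScalarTower.algebraMap_eq]
  obtain ⟨a', b', hab'⟩ : ∃ a' b', q.map (algebraMap (PowerSeries k) E) =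
      C t * ((X - C a') * (X - C b')) := by
    have hs := IsAlgClosed.splits (q.map (algebraMap (PowerSeries k) E))
    have hd : (q.map (algebraMap (PowerSeries k) E)).natDegree = 2 := by
      rw [natDegree_map_eq_of_injective hinj, hqdeg]
    obtain ⟨a', b', h⟩ := Multiset.card_eq_two.1 (hs.natDegree_eq_card_roots.symm.trans hd)
    refine ⟨a', b', ?_⟩
    conv_lhs => rw [hs.eq_prod_roots, h, leadingCoeff, hd, coeff_map, hq2]
    simp [ht]
  have hpE : p.map (algebraMap (RatFunc k) E) =
      (∏ c ∈ s, (X - C (algebraMap (PowerSeries k) E (r c)))) * ((X - C a') * (X - C b')) := by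
    refine mul_left_cancel₀ (C_ne_zero.2 ht0) ?_
    rw [hmap, hq, Polynomial.map_mul, hab', Polynomial.map_prod]
    simp only [Polynomial.map_sub, map_X, map_C]
    ring
  have hne' : a' ≠ b' := by
    rintro rfl
    have := (hpsep.map (f := algebraMap (RatFunc k) E)).squarefree (X - C a')
      (hpE ▸ dvd_mul_left _ _)
    exact not_isUnit_X_sub_C _ this
  have hqroot : ∀ z : E, aeval z (q.map (algebraMap (PowerSeries k) M)) = 0 ↔ z = a' ∨ z = b' := by
    intro z
    rw [← eval_map_algebraMap, ← hqE, hab']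
    simp [ht0, sub_eq_zero]
  -- The quadratic has no root in `M`, hence is irreducible, and up to a scalar it is the minimal
  -- polynomial of both `a'` and `b'`.
  have hconj : IsConjRoot M b' a' := by
    rw [IsConjRoot, ← minpoly.eq_of_irreducible hirr ((hqroot b').2 (.inr rfl)),
      ← minpoly.eq_of_irreducible hirr ((hqroot a').2 (.inl rfl))]
  obtain ⟨θ, hθa⟩ := isConjRoot_iff_exists_algEquiv.1 hconj
  have hθb : θ b' = a' := by
    have : aeval (θ b') (q.map (algebraMap (PowerSeries k) M)) = 0 := by
      have h := congrArg θ ((hqroot b').2 (.inr rfl))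
      rwa [map_zero, ← aeval_algHom_apply] at h
    refine ((hqroot _).1 this).resolve_right fun h => hne' ?_
    exact θ.injective (hθa.trans h.symm)
  have hθ : ∀ z : PowerSeries k, θ (algebraMap _ E z) = algebraMap _ E z := fun z => by
    rw [IsScalarTower.algebraMap_apply (PowerSeries k) M E, θ.commutes]
  let ι : L →ₐ[RatFunc k] E := IsSplittingField.lift L p (IsAlgClosed.splits _)
  have hιp : p.map (algebraMap (RatFunc k) E) =
      ((p.map (algebraMap (RatFunc k) L)).roots.map fun y => X - C (ι y)).prod := by
    have hs := IsSplittingField.splits L p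
    have h := congrArg (Polynomial.map ι.toRingHom) (hs.eq_prod_roots_of_monic (hpmon.map _))
    rw [Polynomial.map_map, AlgHom.toRingHom_eq_coe, AlgHom.comp_algebraMap,
      Polynomial.map_multiset_prod, Multiset.map_map] at h
    simpa using h
  have hroot : ∀ z : E, (p.map (algebraMap (RatFunc k) E)).IsRoot z →
      ∃ y ∈ (p.map (algebraMap (RatFunc k) L)).roots, ι y = z := by
    intro z hz
    rw [hιp, IsRoot, eval_multiset_prod, Multiset.prod_eq_zero_iff] at hz
    simp only [Multiset.map_map, Multiset.mem_map, Function.comp_apply, eval_sub, eval_X, eval_C,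
      sub_eq_zero] at hz
    obtain ⟨y, hy, h⟩ := hz
    exact ⟨y, hy, h.symm⟩
  obtain ⟨a, ha, rfl⟩ := hroot a' (by simp [hpE])
  obtain ⟨b, hb, rfl⟩ := hroot b' (by simp [hpE])
  have hρ : ∀ y ∈ (p.map (algebraMap (RatFunc k) L)).roots, y ≠ a → y ≠ b →
      ∃ z : PowerSeries k, algebraMap (PowerSeries k) E z = ι y := by
    intro y hy hya hyb
    have h : (p.map (algebraMap (RatFunc k) E)).IsRoot (ι y) := by
      rw [hιp, IsRoot, eval_multiset_prod, Multiset.prod_eq_zero_iff]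
      simp only [Multiset.map_map, Multiset.mem_map]
      exact ⟨y, hy, by simp⟩
    rw [hpE, IsRoot, eval_mul, eval_mul, mul_eq_zero, mul_eq_zero, eval_prod,
      Finset.prod_eq_zero_iff] at h
    simp only [eval_sub, eval_X, eval_C, sub_eq_zero] at h
    obtain ⟨c, -, hc⟩ := h.resolve_right fun h =>
      h.elim (fun h => hya (ι.injective h)) fun h => hyb (ι.injective h)
    exact ⟨r c, hc.symm⟩
  choose! ρ hρ using hρ
  have : Normal (RatFunc k) L := Normal.of_isSplittingField p
  obtain ⟨σ, hσ⟩ := exists_algEquiv_comp_eq ι (θ.restrictScalars (RatFunc k))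
  refine ⟨ι, a, b, q, ρ, σ, fun h => hne' (h ▸ rfl), ha, hb, hab', ι.injective ((hσ a).trans hθa),
    ι.injective ((hσ b).trans hθb), fun y hy hya hyb => ⟨ι.injective ((hσ y).trans ?_),
      hρ y hy hya hyb⟩⟩
  change θ (ι y) = ι y
  rw [← hρ y hy hya hyb, hθ]

/-! ### Integral elements without poles at infinity -/

theorem natDegree_eq_zero_of_eval₂_inv_X_mem {k M : Type*} [Field k] [Field M]
    [Algebra (PowerSeries k) M] [IsFractionRing (PowerSeries k) M] (c : k[X]) (u : PowerSeries k)
    (h : c.eval₂ ((algebraMap (PowerSeries k) M).comp PowerSeries.C)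
      (algebraMap (PowerSeries k) M PowerSeries.X)⁻¹ = algebraMap (PowerSeries k) M u) :
    c.natDegree = 0 := by
  by_contra hc
  have hinj := IsFractionRing.injective (PowerSeries k) M
  have ht0 : algebraMap (PowerSeries k) M PowerSeries.X ≠ 0 :=
    (hinj.ne_iff' (map_zero _)).2 PowerSeries.X_ne_zero
  have hc0 : c.leadingCoeff ≠ 0 := leadingCoeff_ne_zero.2 (by rintro rfl; exact hc natDegree_zero)
  -- If `c` had positive degree, `c(T) - u` scaled by the inverse leading coefficient would be a
  -- monic equation for `1 / t` over `k⟦t⟧`.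
  have hint : IsIntegral (PowerSeries k) (algebraMap (PowerSeries k) M PowerSeries.X)⁻¹ := by
    refine ⟨C (PowerSeries.C c.leadingCoeff⁻¹) * (c.map PowerSeries.C - C u), ?_, ?_⟩
    · have hd : (c.map PowerSeries.C - C u).degree = (c.map (PowerSeries.C (R := k))).degree := by
        refine degree_sub_eq_left_of_degree_lt (degree_C_le.trans_lt ?_)
        rw [degree_map_eq_of_injective PowerSeries.C_injective]
        exact natDegree_pos_iff_degree_pos.1 (Nat.pos_of_ne_zero hc)
      have hl : (c.map PowerSeries.C - C u).leadingCoeff = PowerSeries.C c.leadingCoeff := by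
        rw [leadingCoeff, natDegree_eq_of_degree_eq hd,
          natDegree_map_eq_of_injective PowerSeries.C_injective, coeff_sub, coeff_C_of_ne_zero hc,
          sub_zero, coeff_map, leadingCoeff]
      refine monic_C_mul_of_mul_leadingCoeff_eq_one ?_
      rw [hl, ← map_mul, inv_mul_cancel₀ hc0, map_one]
    · rw [eval₂_mul, eval₂_sub, eval₂_map, h, eval₂_C, eval₂_C, sub_self, mul_zero]
  obtain ⟨w, hw⟩ := IsIntegrallyClosed.isIntegral_iff.1 hint
  have : w * PowerSeries.X = 1 := hinj <| by rw [map_mul, hw, inv_mul_cancel₀ ht0, map_one]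
  have := congrArg PowerSeries.constantCoeff this
  simp at this

theorem natDegree_eq_zero_of_algebraMap_eq {k M : Type*} [Field k] [Field M]
    [Algebra (PowerSeries k) M] [IsFractionRing (PowerSeries k) M] [Algebra (RatFunc k) M]
    (hX : algebraMap (RatFunc k) M RatFunc.X * algebraMap (PowerSeries k) M PowerSeries.X = 1)
    (hC : ∀ c, algebraMap (RatFunc k) M (RatFunc.C c) =
      algebraMap (PowerSeries k) M (PowerSeries.C c)) (c : k[X]) (u : PowerSeries k)
    (h : algebraMap (RatFunc k) M (algebraMap k[X] (RatFunc k) c) =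
      algebraMap (PowerSeries k) M u) : c.natDegree = 0 := by
  refine natDegree_eq_zero_of_eval₂_inv_X_mem (M := M) c u (h ▸ ?_)
  have : eval₂RingHom ((algebraMap (PowerSeries k) M).comp PowerSeries.C)
      (algebraMap (PowerSeries k) M PowerSeries.X)⁻¹ =
      (algebraMap (RatFunc k) M).comp (algebraMap k[X] (RatFunc k)) := by
    ext
    · simpa using (hC _).symm
    · simpa using (eq_inv_of_mul_eq_one_left hX).symm
  exact RingHom.congr_fun this c

theorem eval_flowDerivative_ne_zero {E : Type*} [Field E] {G : E[X]} {S : Finset E} {y : E}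
    (hy : y ∈ S) (hG : G.eval y ≠ 0) : (flowDerivative G S).eval y ≠ 0 := by
  rw [eval_flowDerivative G S hy]
  refine mul_ne_zero (pow_ne_zero _ hG) ?_
  have hs : (∏ z ∈ S, (X - C z)).Separable := separable_prod_X_sub_C_iff'.2 fun _ _ _ _ h => h
  refine hs.eval₂_derivative_ne_zero (RingHom.id E) ?_
  rw [← eval, eval_prod, Finset.prod_eq_zero hy (by simp)]

theorem isIntegral_coeff_flowDerivative {R E : Type*} [CommRing R] [Field E] [Algebra R E]
    {G : E[X]} {S : Finset E} (hG : ∀ i, IsIntegral R (G.coeff i)) (hS : ∀ y ∈ S, IsIntegral R y)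
    (i : ℕ) : IsIntegral R ((flowDerivative G S).coeff i) := by
  classical
  have hmem : ∀ {p : E[X]}, p ∈ lifts (algebraMap (integralClosure R E) E) ↔
      ∀ i, IsIntegral R (p.coeff i) := fun {p} => by
    rw [lifts_iff_coeff_lifts]
    simp [mem_integralClosure_iff]
  have hC : ∀ y, IsIntegral R y → C y ∈ lifts (algebraMap (integralClosure R E) E) := fun y hy =>
    C_mem_lifts _ (⟨y, hy⟩ : integralClosure R E)
  refine hmem.1 (sum_mem fun y hy => mul_mem (hC _ (.pow ?_ 2)) (prod_mem fun z hz => ?_)) i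
  · rw [eval_eq_sum]
    exact IsIntegral.sum _ fun i _ => (hG i).mul ((hS y hy).pow i)
  · rw [sub_eq_add_neg, ← C_neg]
    exact add_mem (X_mem_lifts _) (hC _ (hS z (Finset.mem_of_mem_erase hz)).neg)

/-- An element of a Galois extension of `k(X)` that is integral over `k[X]`, has no pole at any place
above infinity and has a zero at one of them vanishes. -/
theorem eq_zero_of_isIntegral_of_zero_at_infinity {k : Type u} [Field k] [IsAlgClosed k]
    {M : Type u} [Field M] [Algebra (PowerSeries k) M]
    [IsFractionRing (PowerSeries k) M] [Algebra (RatFunc k) M]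
    (hX : algebraMap (RatFunc k) M RatFunc.X * algebraMap (PowerSeries k) M PowerSeries.X = 1)
    (hC : ∀ c, algebraMap (RatFunc k) M (RatFunc.C c) =
      algebraMap (PowerSeries k) M (PowerSeries.C c))
    {L : Type v} [Field L] [Algebra (RatFunc k) L] [Algebra k[X] L]
    [IsScalarTower k[X] (RatFunc k) L] [Normal (RatFunc k) L]
    (ι : L →ₐ[RatFunc k] AlgebraicClosure M) {x : L} (hx : IsIntegral k[X] x)
    (h : ∀ σ : L ≃ₐ[RatFunc k] L, ∃ u : PowerSeries k, algebraMap _ _ u = ι (σ x))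
    (h0 : ∃ u : PowerSeries k, algebraMap _ _ (PowerSeries.X * u) = ι x) : x = 0 := by
  set E := AlgebraicClosure M
  have hinj : Function.Injective (algebraMap (PowerSeries k) E) := by
    rw [IsScalarTower.algebraMap_eq (PowerSeries k) M E]
    exact (algebraMap M E).injective.comp (IsFractionRing.injective _ _)
  have hmin := minpoly.isIntegrallyClosed_eq_field_fractions (RatFunc k) L hx
  set m := minpoly k[X] x with hm
  have hmon : m.Monic := minpoly.monic hx
  -- All conjugates of `x` embed into `k⟦t⟧`, hence so do the coefficients of its minimal
  -- polynomial. Being polynomials in `X = 1 / t` as well, these are constants, so `x` is algebraic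
  -- over `k` and therefore in `k`.
  have hlift : (minpoly (RatFunc k) x).map (algebraMap (RatFunc k) E) ∈
      lifts (algebraMap (PowerSeries k) E) := by
    have hs := Normal.splits (F := RatFunc k) ‹_› x
    have hp := hs.eq_prod_roots_of_monic ((minpoly.monic (Normal.isIntegral ‹_› x)).map _)
    have := congrArg (Polynomial.map ι.toRingHom) hp
    rw [Polynomial.map_map, AlgHom.toRingHom_eq_coe, AlgHom.comp_algebraMap,
      Polynomial.map_multiset_prod, Multiset.map_map] at this
    rw [this]
    refine Subsemiring.multiset_prod_mem _ _ fun q hq => ?_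
    obtain ⟨y, hy, rfl⟩ := Multiset.mem_map.1 hq
    obtain ⟨σ, rfl⟩ := isConjRoot_iff_exists_algEquiv.1
      ((isConjRoot_iff_mem_minpoly_aroots (Normal.isIntegral ‹_› x)).2 hy).symm
    obtain ⟨u, hu⟩ := h σ
    refine ⟨X - C u, ?_⟩
    simpa using hu
  have hconst : ∀ i, (m.coeff i).natDegree = 0 := fun i => by
    obtain ⟨u, hu⟩ := (lifts_iff_coeff_lifts _).1 hlift i
    refine natDegree_eq_zero_of_algebraMap_eq hX hC _ u ((algebraMap M E).injective ?_)
    rw [← IsScalarTower.algebraMap_apply (RatFunc k) M E,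
      ← IsScalarTower.algebraMap_apply (PowerSeries k) M E, hu, coeff_map, ← coeff_map, ← hmin]
    rfl
  obtain ⟨m₀, hm₀⟩ : m ∈ lifts (C : k →+* k[X]) := (lifts_iff_coeff_lifts _).2 fun i =>
    ⟨_, (eq_C_of_natDegree_eq_zero (hconst i)).symm⟩
  have hm₀mon : m₀.Monic := monic_of_injective C_injective (by rw [← coe_mapRingHom, hm₀]; exact hmon)
  obtain ⟨c, hc⟩ : ∃ c : k, x = algebraMap k[X] L (C c) := by
    have hz := minpoly.aeval k[X] x
    rw [← hm, ← hm₀, coe_mapRingHom, (IsAlgClosed.splits m₀).eq_prod_roots_of_monic hm₀mon,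
      Polynomial.map_multiset_prod, map_multiset_prod, Multiset.prod_eq_zero_iff] at hz
    simp only [Multiset.map_map, Multiset.mem_map, Function.comp_apply, Polynomial.map_sub, map_X,
      map_C, map_sub, aeval_X, aeval_C, sub_eq_zero] at hz
    obtain ⟨c, -, hc⟩ := hz
    exact ⟨c, hc⟩
  obtain ⟨u, hu⟩ := h0
  have : PowerSeries.X * u = PowerSeries.C c := hinj <| by
    rw [hu, hc, IsScalarTower.algebraMap_apply k[X] (RatFunc k) L, ι.commutes,
      RatFunc.algebraMap_C, IsScalarTower.algebraMap_apply (RatFunc k) M E, hC,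
      ← IsScalarTower.algebraMap_apply]
  have hc0 := congrArg PowerSeries.constantCoeff this
  simp at hc0
  rw [hc, ← hc0, C_0, map_zero]

/-! ### Roots linked by transpositions -/

/-- Some automorphism exchanges `x` and `y` and fixes all other elements of `Z`. -/
def IsTransposable (K : Type*) {L : Type*} [Field K] [Field L] [Algebra K L] (Z : Set L)
    (x y : L) : Prop :=
  ∃ σ : L ≃ₐ[K] L, σ x = y ∧ σ y = x ∧ ∀ z ∈ Z, z ≠ x → z ≠ y → σ z = z

namespace IsTransposable

variable {K L : Type*} [Field K] [Field L] [Algebra K L] {Z : Set L} {x y z : L}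

theorem refl (x : L) : IsTransposable K Z x x := ⟨1, rfl, rfl, fun _ _ _ _ => rfl⟩

theorem symm : IsTransposable K Z x y → IsTransposable K Z y x := fun ⟨σ, h₁, h₂, h₃⟩ =>
  ⟨σ, h₂, h₁, fun z hz hy hx => h₃ z hz hx hy⟩

theorem trans (hx : x ∈ Z) (hz : z ∈ Z) (hxy : IsTransposable K Z x y)
    (hyz : IsTransposable K Z y z) : IsTransposable K Z x z := by
  rcases eq_or_ne x y with rfl | hxy'
  · exact hyz
  rcases eq_or_ne y z with rfl | hyz'
  · exact hxy
  rcases eq_or_ne x z with rfl | hxz'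
  · exact refl _
  obtain ⟨σ, h₁, h₂, h₃⟩ := hxy
  obtain ⟨τ, h₄, h₅, h₆⟩ := hyz
  have hσz : σ z = z := h₃ z hz hxz'.symm hyz'.symm
  have hτx : τ x = x := h₆ x hx hxy' hxz'
  -- `(x y)(y z)(x y) = (x z)`.
  refine ⟨σ * τ * σ, ?_, ?_, fun w hw hwx hwz => ?_⟩ <;> simp only [AlgEquiv.mul_apply]
  · rw [h₁, h₄, hσz]
  · rw [hσz, h₅, h₂]
  · rcases eq_or_ne w y with rfl | hwy
    · rw [h₂, hτx, h₁]
    · rw [h₃ w hw hwx hwy, h₆ w hw hwy hwz, h₃ w hw hwx hwy]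

theorem map (τ : L ≃ₐ[K] L) (hZ : ∀ z ∈ Z, τ.symm z ∈ Z) (h : IsTransposable K Z x y) :
    IsTransposable K Z (τ x) (τ y) := by
  obtain ⟨σ, h₁, h₂, h₃⟩ := h
  refine ⟨τ * σ * τ⁻¹, ?_, ?_, fun z hz hzx hzy => ?_⟩ <;>
    simp only [AlgEquiv.mul_apply, AlgEquiv.aut_inv, AlgEquiv.symm_apply_apply, h₁, h₂]
  rw [h₃ _ (hZ z hz), AlgEquiv.apply_symm_apply]
  · rintro rfl; simp at hzx
  · rintro rfl; simp at hzy

end IsTransposable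

theorem isTransposable_roots_pencil {k : Type u} [Field k] [IsAlgClosed k] [CharP k 2] {f g : k[X]}
    (hfg : derivative (f * g) = 1) {s : Finset k} (hg : g = ∏ c ∈ s, (X - C c)) (hf : f.Monic)
    (hdeg : f.natDegree = s.card + 2) {M : Type u} [Field M] [Algebra (PowerSeries k) M]
    [IsFractionRing (PowerSeries k) M] [Algebra (RatFunc k) M]
    (hX : algebraMap (RatFunc k) M RatFunc.X * algebraMap (PowerSeries k) M PowerSeries.X = 1)
    (hC : ∀ c, algebraMap (RatFunc k) M (RatFunc.C c) =
      algebraMap (PowerSeries k) M (PowerSeries.C c))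
    (L : Type v) [Field L] [Algebra (RatFunc k) L] [Algebra k[X] L]
    [IsScalarTower k[X] (RatFunc k) L]
    [IsSplittingField (RatFunc k) L (overFunctionField (pencil f g))]
    {x y : L} (hx : x ∈ (overFunctionField (pencil f g)).rootSet L)
    (hy : y ∈ (overFunctionField (pencil f g)).rootSet L) :
    IsTransposable (RatFunc k) ((overFunctionField (pencil f g)).rootSet L) x y := by
  classical
  set p := overFunctionField (pencil f g) with hp
  set E := AlgebraicClosure M
  have hgdeg : g.natDegree = s.card := by rw [hg, natDegree_finsetProd_X_sub_C_eq_card]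
  have hlt : g.natDegree < f.natDegree := by lia
  have hfmon : (pencil f g).Monic := monic_pencil hf hlt
  have hpmon : p.Monic := hfmon.map _
  have hpsep : p.Separable :=
    Separable.map (f := algebraMap k[X] (RatFunc k)) (isCoprime_pencil_derivative hfg)
  have : Normal (RatFunc k) L := Normal.of_isSplittingField p
  have hinj : Function.Injective (algebraMap (PowerSeries k) E) := by
    rw [IsScalarTower.algebraMap_eq (PowerSeries k) M E]
    exact (algebraMap M E).injective.comp (IsFractionRing.injective _ _)
  have : FaithfulSMul (PowerSeries k) E := (faithfulSMul_iff_algebraMap_injective _ _).2 hinj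
  obtain ⟨ι, a, b, q, ρ, σ, hab, ha, hb, hq, hσa, hσb, hσ⟩ :=
    exists_transposition_at_infinity hfg hg hf hdeg hX hC L
  set Z := (p.map (algebraMap (RatFunc k) L)).roots.toFinset with hZ
  have hZroot : ∀ y, y ∈ Z ↔ y ∈ p.rootSet L := fun y => by
    rw [mem_rootSet', hZ, Multiset.mem_toFinset, mem_roots', IsRoot, eval_map_algebraMap]
  replace ha : a ∈ Z := Multiset.mem_toFinset.2 ha
  replace hb : b ∈ Z := Multiset.mem_toFinset.2 hb
  replace hσ : ∀ y ∈ Z, y ≠ a → y ≠ b → σ y = y ∧ algebraMap (PowerSeries k) E (ρ y) = ι y :=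
    fun y hy => hσ y (Multiset.mem_toFinset.1 hy)
  have hZσ : ∀ (τ : L ≃ₐ[RatFunc k] L) (y : L), y ∈ p.rootSet L → τ y ∈ p.rootSet L :=
    fun τ y hy => rootSet_mapsTo τ.toAlgHom hy
  set R := IsTransposable (RatFunc k) (p.rootSet L) 
  have hRab : R a b := ⟨σ, hσa, hσb, fun z hz hza hzb => (hσ z ((hZroot z).2 hz) hza hzb).1⟩
  have hRmap : ∀ (τ : L ≃ₐ[RatFunc k] L) {x y}, R x y → R (τ x) (τ y) := fun τ x y h =>
    h.map τ (hZσ τ.symm)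
  -- The factorization at infinity indexed by roots in `L`, so that subsets of roots correspond to
  -- factors over `k⟦t⟧`.
  have hfac : atInfinity f g = q * ∏ y ∈ (Z.erase a).erase b, (X - C (ρ y)) := by
    refine Polynomial.map_injective _ hinj ?_
    have h1 : p.map (algebraMap (RatFunc k) E) = ∏ y ∈ Z, (X - C (ι y)) := by
      have hs := IsSplittingField.splits L p
      have h := congrArg (Polynomial.map ι.toRingHom) (hs.eq_prod_roots_of_monic (hpmon.map _))
      rw [Polynomial.map_map, AlgHom.toRingHom_eq_coe, AlgHom.comp_algebraMap,
        Polynomial.map_multiset_prod, Multiset.map_map] at h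
      rw [h, Finset.prod, hZ, Multiset.toFinset_val, (nodup_roots hpsep.map).dedup]
      simp
    rw [← X_mul_map_overFunctionField_pencil (E := E) f g, ← hp, h1, Polynomial.map_mul, hq,
      ← Finset.mul_prod_erase Z _ ha, ← Finset.mul_prod_erase (Z.erase a) _
        (Finset.mem_erase.2 ⟨hab.symm, hb⟩), Polynomial.map_prod, ← mul_assoc (X - C (ι a)),
      ← mul_assoc]
    · congr 1
      refine Finset.prod_congr rfl fun y hy => ?_
      simp only [Finset.mem_erase] at hy
      simp [(hσ y hy.2.2 hy.2.1 hy.1).2]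
    · rw [IsScalarTower.algebraMap_apply (RatFunc k) M E,
        IsScalarTower.algebraMap_apply (PowerSeries k) M E, ← map_mul, hX, map_one]
    · intro c
      rw [IsScalarTower.algebraMap_apply (RatFunc k) M E,
        IsScalarTower.algebraMap_apply (PowerSeries k) M E, hC]
  set G : L[X] := g.map ((algebraMap (RatFunc k) L).comp RatFunc.C) with hG
  have hGE : G.map ι.toRingHom = (g.map PowerSeries.C).map (algebraMap (PowerSeries k) E) := by
    rw [hG, Polynomial.map_map, Polynomial.map_map]
    congr 1
    ext c
    simp only [RingHom.comp_apply, AlgHom.toRingHom_eq_coe, RingHom.coe_coe, ι.commutes]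
    rw [IsScalarTower.algebraMap_apply (RatFunc k) M E, hC,
      ← IsScalarTower.algebraMap_apply (PowerSeries k) M E]
  have hGσ : ∀ τ : L ≃ₐ[RatFunc k] L, G.map (τ : L →+* L) = G := fun τ => by
    rw [hG, Polynomial.map_map]
    congr 1
    ext c
    simp
  let S : L → Finset L := fun x => Z.filter (R x)
  have hSZ : ∀ x, S x ⊆ Z := fun x => Finset.filter_subset _ _
  have hSσ : ∀ (τ : L ≃ₐ[RatFunc k] L) x,
      (S x).map ⟨(τ : L →+* L), (τ : L →+* L).injective⟩ = S (τ x) := by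
    intro τ x
    ext z
    simp only [S, Finset.mem_map, Finset.mem_filter, Function.Embedding.coeFn_mk, hZroot]
    constructor
    · rintro ⟨w, ⟨hw, hxw⟩, rfl⟩
      exact ⟨hZσ τ w hw, hRmap τ hxw⟩
    · rintro ⟨hz, hxz⟩
      refine ⟨τ.symm z, ⟨hZσ τ.symm z hz, ?_⟩, by simp⟩
      simpa using hRmap τ.symm hxz
  -- Conjugating a coefficient only moves the class, so behaviour at all places over infinity is
  -- read off from all classes through the single embedding `ι`.
  have hWσ : ∀ (τ : L ≃ₐ[RatFunc k] L) x i,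
      τ ((flowDerivative G (S x)).coeff i) = (flowDerivative G (S (τ x))).coeff i := by
    intro τ x i
    rw [← hSσ, ← hGσ τ, ← map_flowDerivative, coeff_map, hGσ]
    rfl
  have hprod : ∀ T : Finset L, T ⊆ (Z.erase a).erase b →
      (∏ y ∈ T, (X - C (ρ y))).map (algebraMap (PowerSeries k) E) = ∏ y ∈ T, (X - C (ι y)) := by
    intro T hT
    rw [Polynomial.map_prod]
    refine Finset.prod_congr rfl fun y hy => ?_
    have hy := hT hy
    simp only [Finset.mem_erase] at hy
    simp [(hσ y hy.2.2 hy.2.1 hy.1).2]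
  have hzero : ∀ x, a ∉ S x → b ∉ S x → ∃ V : (PowerSeries k)[X],
      (flowDerivative G (S x)).map ι.toRingHom =
        (C PowerSeries.X * V).map (algebraMap (PowerSeries k) E) := by
    intro x hax hbx
    have hsub : S x ⊆ (Z.erase a).erase b := Finset.subset_erase.2
      ⟨Finset.subset_erase.2 ⟨hSZ x, hax⟩, hbx⟩
    rw [map_flowDerivative, hGE]
    refine ⟨_, flowDerivative_eq_of_map_eq_prod hfg (p := ∏ y ∈ S x, (X - C (ρ y)))
      (q := q * ∏ y ∈ (Z.erase a).erase b \ S x, (X - C (ρ y))) ?_ ?_⟩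
    · rw [hfac, ← Finset.prod_sdiff hsub]
      ring
    · rw [hprod _ hsub, Finset.prod_map]
      rfl
  have hpole : ∀ x, a ∈ S x → b ∈ S x → ∃ V : (PowerSeries k)[X],
      (flowDerivative G (S x)).map ι.toRingHom = V.map (algebraMap (PowerSeries k) E) := by
    intro x hax hbx
    have hsub : ((S x).erase a).erase b ⊆ (Z.erase a).erase b :=
      Finset.erase_subset_erase _ (Finset.erase_subset_erase _ (hSZ x))
    rw [map_flowDerivative, hGE]
    refine ⟨_, flowDerivative_eq_of_map_eq_X_mul_prod hfg
      (p := q * ∏ y ∈ ((S x).erase a).erase b, (X - C (ρ y)))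
      (q := ∏ y ∈ (Z.erase a).erase b \ ((S x).erase a).erase b, (X - C (ρ y))) ?_ ?_⟩
    · rw [hfac, ← Finset.prod_sdiff hsub]
      ring
    · rw [Polynomial.map_mul, hprod _ hsub, hq, Finset.prod_map, ← Finset.mul_prod_erase (S x) _ hax,
        ← Finset.mul_prod_erase ((S x).erase a) _ (Finset.mem_erase.2 ⟨hab.symm, hbx⟩),
        mul_assoc, mul_assoc]
      rfl
  have hSab : ∀ x ∈ Z, (a ∈ S x ↔ b ∈ S x) := fun x hx => by
    simp only [S, Finset.mem_filter, ha, hb, true_and]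
    have hx := (hZroot x).1 hx
    exact ⟨fun h => h.trans hx ((hZroot b).1 hb) hRab,
      fun h => h.trans hx ((hZroot a).1 ha) hRab.symm⟩
  have hint : ∀ y ∈ Z, IsIntegral k[X] y := fun y hy => by
    refine ⟨pencil f g, hfmon, ?_⟩
    have := (mem_rootSet.1 ((hZroot y).1 hy)).2
    rwa [hp, overFunctionField, aeval_map_algebraMap] at this
  have hGint : ∀ i, IsIntegral k[X] (G.coeff i) := fun i => by
    have : G.coeff i = algebraMap k[X] L (C (g.coeff i)) := by
      rw [hG, coeff_map, IsScalarTower.algebraMap_apply k[X] (RatFunc k) L, RatFunc.algebraMap_C]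
      rfl
    rw [this]
    exact isIntegral_algebraMap
  -- If `g(y) = 0`, then `f(y) = -X g(y) = 0`, against the coprimality of `f` and `g`.
  have hGne : ∀ y ∈ Z, G.eval y ≠ 0 := fun y hy h => by
    have hpy := (mem_rootSet.1 ((hZroot y).1 hy)).2
    obtain ⟨u, w, huw⟩ := (isCoprime_of_derivative_mul_eq_one hfg).map
      (mapRingHom ((algebraMap (RatFunc k) L).comp RatFunc.C))
    have hF : (f.map ((algebraMap (RatFunc k) L).comp RatFunc.C)).eval y +
        algebraMap (RatFunc k) L RatFunc.X * G.eval y = 0 := by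
      rw [← hpy, ← eval_map_algebraMap, hp, overFunctionField, pencil, hG]
      simp [Polynomial.map_map]
    rw [h, mul_zero, add_zero] at hF
    have := congrArg (eval y) huw
    simp only [coe_mapRingHom, ← hG, eval_add, eval_mul, hF, h, mul_zero, add_zero, eval_one] at this
    exact zero_ne_one this
  suffices hall : ∀ x ∈ Z, R x a by
    have hx := (hZroot x).2 hx
    exact (hall x hx).trans ((hZroot x).1 hx) hy (hall y ((hZroot y).2 hy)).symm
  intro x hx
  by_contra hxa
  have hax : a ∉ S x := fun h => hxa (Finset.mem_filter.1 h).2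
  -- The class of `x` misses `a`, and so `b`: the coefficients vanish at the place given by `ι`,
  -- while their conjugates are regular there by `hzero` or `hpole`.
  have hW : flowDerivative G (S x) = 0 := by
    ext i
    rw [coeff_zero]
    refine eq_zero_of_isIntegral_of_zero_at_infinity hX hC ι
      (isIntegral_coeff_flowDerivative hGint (fun y hy => hint y (hSZ x hy)) i) (fun τ => ?_) ?_
    · have hτx : τ x ∈ Z := (hZroot _).2 (hZσ τ x ((hZroot _).1 hx))
      obtain ⟨V, hV⟩ : ∃ V : (PowerSeries k)[X], (flowDerivative G (S (τ x))).map ι.toRingHom =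
          V.map (algebraMap (PowerSeries k) E) := by
        by_cases h : a ∈ S (τ x)
        · exact hpole _ h ((hSab _ hτx).1 h)
        · exact (hzero _ h fun hb => h ((hSab _ hτx).2 hb)).elim fun V hV => ⟨_, hV⟩
      refine ⟨V.coeff i, ?_⟩
      rw [hWσ, ← coeff_map, ← hV, coeff_map]
      rfl
    · obtain ⟨V, hV⟩ := hzero x hax fun hb => hax ((hSab x hx).2 hb)
      refine ⟨V.coeff i, ?_⟩
      rw [← coeff_C_mul, ← coeff_map, ← hV, coeff_map]
      rfl
  refine eval_flowDerivative_ne_zero (S := S x) (Finset.mem_filter.2 ⟨hx, IsTransposable.refl x⟩)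
    (hGne x hx) ?_
  rw [hW, eval_zero]

/-! ### Existence of the data and conclusion -/

theorem exists_ringHom_ratFunc_of_isFractionRing_powerSeries (k : Type u) [Field k] (M : Type u)
    [Field M] [Algebra (PowerSeries k) M] [IsFractionRing (PowerSeries k) M] :
    ∃ φ : RatFunc k →+* M, φ RatFunc.X * algebraMap (PowerSeries k) M PowerSeries.X = 1 ∧
      ∀ c, φ (RatFunc.C c) = algebraMap (PowerSeries k) M (PowerSeries.C c) := by
  have ht0 : algebraMap (PowerSeries k) M PowerSeries.X ≠ 0 :=
    ((IsFractionRing.injective (PowerSeries k) M).ne_iff' (map_zero _)).2 PowerSeries.X_ne_zero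
  let φ₀ : k[X] →+* M := eval₂RingHom ((algebraMap (PowerSeries k) M).comp PowerSeries.C)
    (algebraMap (PowerSeries k) M PowerSeries.X)⁻¹
  have hφ₀ : Function.Injective φ₀ := by
    rw [injective_iff_map_eq_zero]
    intro c hc
    have := natDegree_eq_zero_of_eval₂_inv_X_mem (M := M) c 0 (by rw [map_zero]; exact hc)
    rw [eq_C_of_natDegree_eq_zero this] at hc ⊢
    have hc' : ((algebraMap (PowerSeries k) M).comp PowerSeries.C) (c.coeff 0) = 0 := by
      simpa [φ₀] using hc
    rw [(map_eq_zero _).1 hc', C_0]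
  refine ⟨IsFractionRing.lift hφ₀, ?_, fun c => ?_⟩
  · rw [← RatFunc.algebraMap_X, IsFractionRing.lift_algebraMap]
    simp [φ₀, ht0]
  · rw [← RatFunc.algebraMap_C, IsFractionRing.lift_algebraMap]
    simp [φ₀]

/-- With `m = n - 2`, the even exponent makes `(Y ^ (2m + 2) + Y)' = 1` in characteristic 2, so the
polynomial has `2m + 2` distinct roots. Any `m` of them serve for `g`, and the remaining `m + 2 = n`
for `f`. -/
theorem exists_pencil_of_derivative_mul_eq_one (k : Type u) [Field k] [IsAlgClosed k] [CharP k 2]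
    {n : ℕ} (hn : 2 ≤ n) : ∃ (f : k[X]) (s : Finset k), f.Monic ∧ f.natDegree = n ∧
      f.natDegree = s.card + 2 ∧ derivative (f * ∏ c ∈ s, (X - C c)) = 1 := by
  classical
  obtain ⟨m, rfl⟩ := Nat.exists_eq_add_of_le' hn
  set p : k[X] := X ^ (2 * (m + 1)) + X with hp
  have hder : derivative p = 1 := by
    have h2 : (2 : k) = 0 := CharTwo.two_eq_zero
    simp [hp, derivative_X_pow, h2]
  have hmon : p.Monic := monic_X_pow_add (by rw [degree_X]; exact_mod_cast (by lia))
  have hdeg : p.natDegree = 2 * (m + 1) := by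
    rw [hp, natDegree_add_eq_left_of_natDegree_lt] <;> rw [natDegree_X_pow]
    rw [natDegree_X]
    lia
  have hsep : p.Separable := by rw [separable_def, hder]; exact isCoprime_one_right
  have hprod : p = ∏ c ∈ p.roots.toFinset, (X - C c) := by
    rw [Finset.prod, Multiset.toFinset_val, (nodup_roots hsep).dedup]
    exact (IsAlgClosed.splits p).eq_prod_roots_of_monic hmon
  have hcard : p.roots.toFinset.card = 2 * (m + 1) := by
    rw [Multiset.toFinset_card_of_nodup (nodup_roots hsep),
      ← (IsAlgClosed.splits p).natDegree_eq_card_roots, hdeg]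
  obtain ⟨s, hs, hsm⟩ := Finset.exists_subset_card_eq (s := p.roots.toFinset) (n := m) (by lia)
  have hf : (∏ c ∈ p.roots.toFinset \ s, (X - C c)).natDegree = m + 2 := by
    rw [natDegree_finsetProd_X_sub_C_eq_card, Finset.card_sdiff_of_subset hs]
    lia
  refine ⟨∏ c ∈ p.roots.toFinset \ s, (X - C c), s, monic_prod_X_sub_C _ _, hf, by rw [hf, hsm], ?_⟩
  rw [Finset.prod_sdiff hs, ← hprod, hder]

theorem galoisPermGroup_eq_top {k : Type u} [Field k] {F : k[X][X]}
    (h : ∀ x ∈ (overFunctionField F).rootSet (overFunctionField F).SplittingField,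
      ∀ y ∈ (overFunctionField F).rootSet (overFunctionField F).SplittingField,
        IsTransposable (RatFunc k)
          ((overFunctionField F).rootSet (overFunctionField F).SplittingField) x y) :
    galoisPermGroup F = ⊤ := by
  classical
  rw [eq_top_iff, ← Equiv.Perm.closure_isSwap, Subgroup.closure_le]
  rintro _ ⟨x, y, -, rfl⟩
  obtain ⟨σ, hx, hy, hz⟩ := h x x.2 y y.2
  have : Fact (((overFunctionField F).map
      (algebraMap (RatFunc k) (overFunctionField F).SplittingField)).Splits) :=
    ⟨SplittingField.splits _⟩
  refine ⟨Gal.restrict _ _ σ, Equiv.ext fun z => Subtype.ext ?_⟩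
  refine (Gal.galActionHom_restrict _ _ σ z).trans ?_
  rcases eq_or_ne z x with rfl | hzx
  · rw [Equiv.swap_apply_left, hx]
  rcases eq_or_ne z y with rfl | hzy
  · rw [Equiv.swap_apply_right, hy]
  rw [Equiv.swap_apply_of_ne_of_ne hzx hzy]
  exact hz z z.2 (Subtype.coe_ne_coe.2 hzx) (Subtype.coe_ne_coe.2 hzy)

theorem memPiAAffineLine_of_galoisPermGroup_eq_top {k : Type u} [Field k] [IsAlgClosed k]
    {F : k[X][X]} (hF : F.Monic) (hcop : IsCoprime F (derivative F)) (h : galoisPermGroup F = ⊤) :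
    MemPiAAffineLine k (Equiv.Perm (Fin F.natDegree)) := by
  have hsep : (overFunctionField F).Separable :=
    Separable.map (f := algebraMap k[X] (RatFunc k)) hcop
  let L := (overFunctionField F).SplittingField
  have hfact : Fact (((overFunctionField F).map (algebraMap (RatFunc k) L)).Splits) :=
    ⟨SplittingField.splits _⟩
  refine ⟨L, inferInstance, inferInstance, inferInstance, inferInstance,
    IsSplittingField.finiteDimensional L (overFunctionField F),
    IsGalois.of_separable_splitting_field hsep, unramifiedOverAffineLine_of_isCoprime hF hcop L, ?_⟩
  have hcard : Fintype.card ((overFunctionField F).rootSet L) = F.natDegree := by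
    rw [card_rootSet_eq_natDegree hsep hfact.out, overFunctionField, hF.natDegree_map]
  exact ⟨(MulEquiv.ofBijective (Gal.galActionHom (overFunctionField F) L)
    ⟨Gal.galActionHom_injective _ _, MonoidHom.range_eq_top.1 h⟩).trans
      (Fintype.equivFinOfCardEq hcard).permCongrHom⟩

end

theorem mainTheorem2 (k : Type u) [Field k] [IsAlgClosed k] [CharP k 2] (n : ℕ) (hn : 2 ≤ n) :
    (∃ F : k[X][X], IsUnramifiedCovering F ∧ F.natDegree = n ∧ galoisPermGroup F = ⊤) ∧
      MemPiAAffineLine k (Equiv.Perm (Fin n)) := by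
  obtain ⟨f, s, hf, rfl, hdeg, hfg⟩ := exists_pencil_of_derivative_mul_eq_one k hn
  have hlt : (∏ c ∈ s, (X - C c)).natDegree < f.natDegree := by
    rw [natDegree_finsetProd_X_sub_C_eq_card]
    lia
  have hmon := monic_pencil hf hlt
  have hcop := isCoprime_pencil_derivative hfg
  have hnat := natDegree_pencil hlt
  have htop : galoisPermGroup (pencil f (∏ c ∈ s, (X - C c))) = ⊤ := by
    obtain ⟨φ, hX, hC⟩ :=
      exists_ringHom_ratFunc_of_isFractionRing_powerSeries k (FractionRing (PowerSeries k))
    let _ : Algebra (RatFunc k) (FractionRing (PowerSeries k)) := φ.toAlgebra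
    exact galoisPermGroup_eq_top fun x hx y hy =>
      isTransposable_roots_pencil hfg rfl hf hdeg hX hC _ hx hy
  refine ⟨⟨_, isUnramifiedCovering_of_isCoprime hmon hcop, hnat, htop⟩, ?_⟩
  rw [← hnat]
  exact memPiAAffineLine_of_galoisPermGroup_eq_top hmon hcop htop
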